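/- Let $0<a<b<\infty$, $0<c<d<\infty$, $-1<p,q\le 0$, and let $f:[a,b]\times[c,d]\to\mathbb{R}$ be continuous. For $\alpha,\beta>0$ let $$F_{\alpha,\beta}(x,y)=\frac{(p+1)^{1-\alpha}(q+1)^{1-\beta}}{\Gamma(\alpha)\Gamma(\beta)}\int_a^x\int_c^y (x^{p+1}-s^{p+1})^{\alpha-1}(y^{q+1}-t^{q+1})^{\beta-1}s^p t^q f(s,t)\,\mathrm{d}t\,\mathrm{d}s$$ for $(x,y)\in[a,b]\times[c,d]$ be the mixed Katugampola fractional integral of $f$, and let $G_{\alpha,\beta}=\{(x,y,F_{\alpha,\beta}(x,y)):(x,y)\in[a,b]\times[c,d]\}\subset\mathbb{R}^3$ be its graph. Write $\dim_H$ for the Hausdorff dimension, and $$\underline{\dim}_B A=\liminf_{\delta\to0^+}\frac{\log N_\delta(A)}{-\log\delta},\qquad \overline{\dim}_B A=\limsup_{\delta\to0^+}\frac{\log N_\delta(A)}{-\log\delta}$$ for the lower and upper box dimensions, where $N_\delta(A)$ is the number of cubes $\prod_{i=1}^{3}[k_i\delta,(k_i+1)\delta]$, $k_i\in\mathbb{Z}$,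 that intersect $A$. Then: 1. If $0<\alpha<1$ and $0<\beta<1$, then $$2\le\dim_H G_{\alpha,\beta}\le\underline{\dim}_B G_{\alpha,\beta}\le\overline{\dim}_B G_{\alpha,\beta}\le 3-\min\{\alpha,\beta\}.$$ 2. If $\alpha\ge1$ and $\beta\ge1$, then the box dimension of $G_{\alpha,\beta}$ exists and $$\dim_H G_{\alpha,\beta}=\underline{\dim}_B G_{\alpha,\beta}=\overline{\dim}_B G_{\alpha,\beta}=2.$$ -/

import Mathlib

open Set Filter Topology
open scoped ENNReal

noncomputable section

/-- The mixed (left-hand sided) Katugampola fractional integral with base point `(a, c)`, parameters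
`(p, q)` and order `(α, β)` of a function `f` of two variables, at the point `z = (x, y)`. -/
def mixedKatugampola (a c p q α β : ℝ) (f : ℝ × ℝ → ℝ) (z : ℝ × ℝ) : ℝ :=
  (p + 1) ^ (1 - α) * (q + 1) ^ (1 - β) / (Real.Gamma α * Real.Gamma β) *
    ∫ s in a..z.1, ∫ t in c..z.2,
      (z.1 ^ (p + 1) - s ^ (p + 1)) ^ (α - 1) * (z.2 ^ (q + 1) - t ^ (q + 1)) ^ (β - 1) *
        s ^ p * t ^ q * f (s, t)

/-- The graph of `F` over the rectangle `[a, b] × [c, d]`, as a subset of Euclidean 3-space. -/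
def graphOnRect (a b c d : ℝ) (F : ℝ × ℝ → ℝ) : Set (EuclideanSpace ℝ (Fin 3)) :=
  (fun z : ℝ × ℝ => !₂[z.1, z.2, F z]) '' (Icc a b ×ˢ Icc c d)

/-- The cube `∏ i, [k i * δ, (k i + 1) * δ]` of the `δ`-mesh of `ℝⁿ`. -/
def meshCube {n : ℕ} (δ : ℝ) (k : Fin n → ℤ) : Set (EuclideanSpace ℝ (Fin n)) :=
  {x | ∀ i, x i ∈ Icc ((k i : ℝ) * δ) (((k i : ℝ) + 1) * δ)}

/-- The number `N_δ(A)` of cubes of the `δ`-mesh of `ℝⁿ` that intersect `A`. -/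
def meshCount {n : ℕ} (δ : ℝ) (A : Set (EuclideanSpace ℝ (Fin n))) : ℕ∞ :=
  {k : Fin n → ℤ | (meshCube δ k ∩ A).Nonempty}.encard

/-- The quotient `log N_δ(A) / (- log δ)`, in the extended reals. -/
def boxRatio {n : ℕ} (A : Set (EuclideanSpace ℝ (Fin n))) (δ : ℝ) : EReal :=
  ENNReal.log (meshCount δ A : ℝ≥0∞) / ((-Real.log δ : ℝ) : EReal)

/-- The lower box dimension: the lower limit of `log N_δ(A) / (- log δ)` as `δ → 0⁺`. -/
def lowerBoxDim {n : ℕ} (A : Set (EuclideanSpace ℝ (Fin n))) : EReal :=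
  liminf (boxRatio A) (𝓝[>] (0 : ℝ))

/-- The upper box dimension: the upper limit of `log N_δ(A) / (- log δ)` as `δ → 0⁺`. -/
def upperBoxDim {n : ℕ} (A : Set (EuclideanSpace ℝ (Fin n))) : EReal :=
  limsup (boxRatio A) (𝓝[>] (0 : ℝ))

end

/-! The lower bound 2 needs nothing about the function: projecting the graph to the first two
coordinates is 1-Lipschitz and covers a rectangle. The inequality between Hausdorff and lower box
dimension holds for any nonempty set, since mesh cubes are admissible covers.

The upper bound comes from smoothing. Fractional integration of order `α` turns a bounded function
into a Hölder one of exponent `min α 1` (`exists_holder_katugampolaIntegral`), because the kernel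
has an explicit primitive and the difference of two kernels has constant sign. Applying this in each
variable bounds the oscillation of the mixed integral on a `δ`-square by a multiple of `δ ^ γ`,
where `γ = min (min α 1) (min β 1)`. Over each of the `O(δ⁻²)` columns the graph then meets `O(δ ^
(γ - 1))` cubes, so the upper box dimension is at most `3 - γ`; for `α, β ≥ 1` this is 2 and all the
dimensions agree. -/

/-! ### Mesh covers: Hausdorff dimension against box dimension -/

open MeasureTheory in
theorem ediam_meshCube_le {n : ℕ} {δ : ℝ} (k : Fin n → ℤ) :
    Metric.ediam (meshCube δ k) ≤ ENNReal.ofReal (√n * δ) := by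
  refine Metric.ediam_le fun x hx y hy => ?_
  rw [edist_dist]
  apply ENNReal.ofReal_le_ofReal
  rcases Nat.eq_zero_or_pos n with rfl | hn
  · simp [EuclideanSpace.dist_eq]
  have hδ : 0 ≤ δ := by
    have := hx ⟨0, hn⟩
    have := this.1.trans this.2
    linarith
  rw [EuclideanSpace.dist_eq]
  apply Real.sqrt_le_iff.2
  refine ⟨by positivity, ?_⟩
  rw [mul_pow, Real.sq_sqrt (by positivity)]
  calc ∑ i, dist (x i) (y i) ^ 2 ≤ ∑ _i : Fin n, δ ^ 2 := by
        refine Finset.sum_le_sum fun i _ => ?_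
        refine pow_le_pow_left₀ dist_nonneg ?_ 2
        rw [Real.dist_eq, abs_le]
        have h1 := hx i
        have h2 := hy i
        simp only [mem_Icc] at h1 h2
        constructor <;> linarith
    _ = n * δ ^ 2 := by simp

theorem subset_iUnion_meshCube {n : ℕ} {δ : ℝ} (hδ : 0 < δ)
    (A : Set (EuclideanSpace ℝ (Fin n))) :
    A ⊆ ⋃ k : {k : Fin n → ℤ | (meshCube δ k ∩ A).Nonempty}, meshCube δ k.1 := by
  intro x hx
  have h : x ∈ meshCube δ (fun i => ⌊x i / δ⌋) := by
    intro i
    constructor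
    · rw [← le_div_iff₀ hδ]; exact Int.floor_le _
    · rw [← div_le_iff₀ hδ]; exact (Int.lt_floor_add_one _).le
  exact mem_iUnion.2 ⟨⟨_, ⟨x, h, hx⟩⟩, h⟩

theorem one_le_meshCount {n : ℕ} {δ : ℝ} (hδ : 0 < δ) {A : Set (EuclideanSpace ℝ (Fin n))}
    (hA : A.Nonempty) : 1 ≤ meshCount δ A := by
  obtain ⟨x, hx⟩ := hA
  obtain ⟨k, -⟩ := mem_iUnion.1 (subset_iUnion_meshCube hδ A hx)
  exact Set.one_le_encard_iff_nonempty.2 ⟨k.1, k.2⟩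

theorem lowerBoxDim_nonneg {n : ℕ} {A : Set (EuclideanSpace ℝ (Fin n))} (hA : A.Nonempty) :
    0 ≤ lowerBoxDim A := by
  refine le_liminf_of_le (by isBoundedDefault) ?_
  filter_upwards [Ioo_mem_nhdsGT (zero_lt_one' ℝ)] with δ hδ
  refine EReal.div_nonneg ?_ ?_
  · rw [← ENNReal.log_one]
    apply ENNReal.log_monotone
    exact_mod_cast one_le_meshCount hδ.1 hA
  · exact_mod_cast (neg_pos.2 (Real.log_neg hδ.1 hδ.2)).le

theorem lowerBoxDim_le_upperBoxDim {n : ℕ} (A : Set (EuclideanSpace ℝ (Fin n))) :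
    lowerBoxDim A ≤ upperBoxDim A := liminf_le_limsup

theorem meshCount_le_of_boxRatio_le {n : ℕ} {A : Set (EuclideanSpace ℝ (Fin n))} {δ r : ℝ}
    (hδ : δ ∈ Ioo (0 : ℝ) 1) (h : boxRatio A δ ≤ r) :
    (meshCount δ A : ℝ≥0∞) ≤ ENNReal.ofReal (δ ^ (-r)) := by
  have hl : 0 < -Real.log δ := neg_pos.2 (Real.log_neg hδ.1 hδ.2)
  rw [boxRatio, EReal.div_le_iff_le_mul (by exact_mod_cast hl) (by exact EReal.coe_ne_top _)] at h
  rw [← ENNReal.log_le_log_iff, ENNReal.log_ofReal_of_pos (Real.rpow_pos_of_pos hδ.1 _),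
    Real.log_rpow hδ.1]
  refine h.trans ?_
  rw [← EReal.coe_mul]
  apply le_of_eq
  congr 1
  ring

-- For `r` strictly between the two dimensions, there are arbitrarily small `δ` with at most `δ ^
-- (-r)` cubes, each of diameter at most `√n * δ`. The covering sums stay below `√n ^ r`,
-- contradicting infinite `r`-dimensional measure.
open MeasureTheory in
theorem dimH_le_lowerBoxDim {n : ℕ} {A : Set (EuclideanSpace ℝ (Fin n))} (hA : A.Nonempty) :
    (dimH A : EReal) ≤ lowerBoxDim A := by
  by_contra! hlt
  obtain ⟨r, hr1, hr2⟩ := EReal.lt_iff_exists_real_btwn.1 hlt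
  have hr0 : 0 ≤ r := by exact_mod_cast ((lowerBoxDim_nonneg hA).trans hr1.le)
  lift r to NNReal using hr0
  have hr2 : (r : ℝ≥0∞) < dimH A := EReal.coe_ennreal_lt_coe_ennreal_iff.1 hr2
  have hf : ∃ᶠ δ in 𝓝[>] (0 : ℝ), boxRatio A δ < ((r : ℝ) : EReal) :=
    frequently_lt_of_liminf_lt (by isBoundedDefault) hr1
  borelize (EuclideanSpace ℝ (Fin n))
  have htop : μH[r] A = ∞ := hausdorffMeasure_of_lt_dimH hr2
  -- The count is controlled only at frequently many scales, so the limit is taken along those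
  -- scales alone.
  set l := 𝓝[>] (0 : ℝ) ⊓ 𝓟 {δ | boxRatio A δ < ((r : ℝ) : EReal)} with hl
  have : l.NeBot := frequently_mem_iff_neBot.1 hf
  have hll : l ≤ 𝓝[>] (0 : ℝ) := inf_le_left
  have h0 : Tendsto (fun δ : ℝ => ENNReal.ofReal (√n * δ)) l (𝓝 0) := by
    have : Tendsto (fun δ : ℝ => ENNReal.ofReal (√n * δ)) (𝓝 0) (𝓝 (ENNReal.ofReal (√n * 0))) :=
      (ENNReal.continuous_ofReal.comp (continuous_const.mul continuous_id)).tendsto 0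
    simp only [mul_zero, ENNReal.ofReal_zero] at this
    exact this.mono_left (hll.trans nhdsWithin_le_nhds)
  have key := Measure.hausdorffMeasure_le_liminf_tsum (l := l) (r : ℝ) A
    (fun δ : ℝ => ENNReal.ofReal (√n * δ)) h0
    (ι := fun δ => {k : Fin n → ℤ | (meshCube δ k ∩ A).Nonempty})
    (fun δ k => meshCube δ k.1) (Eventually.of_forall fun δ k => ediam_meshCube_le k.1)
    (by
      filter_upwards [hll self_mem_nhdsWithin] with δ hδ
      exact subset_iUnion_meshCube hδ A)
  have hb : liminf (fun δ : ℝ =>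
      ∑' k : {k : Fin n → ℤ | (meshCube δ k ∩ A).Nonempty},
        Metric.ediam (meshCube δ k.1) ^ (r : ℝ)) l ≤ ENNReal.ofReal (√n ^ (r : ℝ)) := by
    refine liminf_le_of_frequently_le' (Eventually.frequently ?_)
    filter_upwards [hll (Ioo_mem_nhdsGT (zero_lt_one' ℝ)),
      mem_inf_of_right (mem_principal_self _)] with δ hδ hδr
    calc _ ≤ ∑' _k : {k : Fin n → ℤ | (meshCube δ k ∩ A).Nonempty},
          ENNReal.ofReal (√n * δ) ^ (r : ℝ) :=
          ENNReal.tsum_le_tsum fun k => ENNReal.rpow_le_rpow (ediam_meshCube_le k.1) r.2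
      _ = meshCount δ A * ENNReal.ofReal (√n * δ) ^ (r : ℝ) := by
          rw [ENNReal.tsum_const]; rfl
      _ ≤ ENNReal.ofReal (δ ^ (-(r : ℝ))) * ENNReal.ofReal (√n * δ) ^ (r : ℝ) := by
          gcongr
          exact meshCount_le_of_boxRatio_le hδ (le_of_lt hδr)
      _ = ENNReal.ofReal (√n ^ (r : ℝ)) := by
          have := hδ.1
          rw [ENNReal.ofReal_rpow_of_nonneg (by positivity) r.coe_nonneg,
            ← ENNReal.ofReal_mul (by positivity), Real.mul_rpow (by positivity) this.le,
            Real.rpow_neg this.le]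
          congr 1
          field_simp
  rw [htop] at key
  exact absurd (key.trans hb) (by simp)

/-! ### Lower bound by projection -/

theorem two_le_dimH_graphOnRect {a b c d : ℝ} (hab : a < b) (hcd : c < d) (F : ℝ × ℝ → ℝ) :
    2 ≤ dimH (graphOnRect a b c d F) := by
  have him : (fun v : EuclideanSpace ℝ (Fin 3) => (v 0, v 1)) '' graphOnRect a b c d F =
      Icc a b ×ˢ Icc c d := by
    rw [graphOnRect, image_image]
    simp
  have hL : LipschitzWith 1 (fun v : EuclideanSpace ℝ (Fin 3) => (v 0, v 1)) := by
    have h (i : Fin 3) : LipschitzWith 1 (fun v : EuclideanSpace ℝ (Fin 3) => v i) :=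
      LipschitzWith.of_dist_le_mul fun x y => by
        simpa [dist_eq_norm] using PiLp.norm_apply_le (x - y) i
    simpa using (h 0).prodMk (h 1)
  have h2 : dimH (Icc a b ×ˢ Icc c d : Set (ℝ × ℝ)) = 2 := by
    rw [Real.dimH_of_nonempty_interior]
    · simp
    · rw [interior_prod_eq, interior_Icc, interior_Icc]
      exact (nonempty_Ioo.2 hab).prod (nonempty_Ioo.2 hcd)
  calc (2 : ℝ≥0∞) = dimH (Icc a b ×ˢ Icc c d : Set (ℝ × ℝ)) := h2.symm
    _ ≤ dimH (graphOnRect a b c d F) := him ▸ hL.dimH_image_le _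

/-! ### Counting mesh cubes over a graph -/

theorem card_Icc_floor_le {u v : ℝ} (huv : u ≤ v) :
    ((Finset.Icc ⌊u⌋ ⌊v⌋).card : ℝ) ≤ v - u + 2 := by
  have h := Int.floor_le v
  have h' := Int.sub_one_lt_floor u
  have h1 : ⌊u⌋ ≤ ⌊v⌋ := Int.floor_le_floor huv
  have : ((Finset.Icc ⌊u⌋ ⌊v⌋).card : ℤ) = ⌊v⌋ + 1 - ⌊u⌋ := by
    rw [Int.card_Icc]; omega
  have : ((Finset.Icc ⌊u⌋ ⌊v⌋).card : ℝ) = ⌊v⌋ + 1 - ⌊u⌋ := by exact_mod_cast this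
  linarith

theorem mem_Icc_floor_of_mem_cell {u v x δ : ℝ} {k : ℤ} (hδ : 0 < δ) (hx : x ∈ Icc u v)
    (hk : x ∈ Icc ((k : ℝ) * δ) (((k : ℝ) + 1) * δ)) :
    k ∈ Finset.Icc ⌊u / δ - 1⌋ ⌊v / δ⌋ := by
  rw [Finset.mem_Icc]
  constructor
  · have : u / δ - 1 ≤ k := by
      rw [sub_le_iff_le_add, div_le_iff₀ hδ]; exact hx.1.trans hk.2
    exact_mod_cast (Int.floor_le _).trans this
  · rw [Int.le_floor, le_div_iff₀ hδ]; exact hk.1.trans hx.2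

theorem meshCount_graphOnRect_le {a b c d : ℝ} (hab : a ≤ b) (hcd : c ≤ d) {F : ℝ × ℝ → ℝ}
    {δ η : ℝ} (hδ : 0 < δ) (hη : 0 ≤ η)
    (hF : ∀ z ∈ Icc a b ×ˢ Icc c d, ∀ w ∈ Icc a b ×ˢ Icc c d,
      |z.1 - w.1| ≤ δ → |z.2 - w.2| ≤ δ → |F z - F w| ≤ η) :
    (meshCount δ (graphOnRect a b c d F) : ℝ≥0∞) ≤
      ENNReal.ofReal (((b - a) / δ + 3) * ((d - c) / δ + 3) * (2 * η / δ + 3)) := by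
  classical
  -- In each column one sampled value of `F` serves as centre; every other value in the column lies
  -- within `η` of it.
  let col (i j : ℤ) : Set (ℝ × ℝ) :=
    (Icc a b ×ˢ Icc c d) ∩ (Icc (i * δ) ((i + 1) * δ) ×ˢ Icc (j * δ) ((j + 1) * δ))
  let base (i j : ℤ) : ℝ := if h : (col i j).Nonempty then F h.some else 0
  let S : Finset (Fin 3 → ℤ) :=
    (Finset.Icc ⌊a / δ - 1⌋ ⌊b / δ⌋ ×ˢ Finset.Icc ⌊c / δ - 1⌋ ⌊d / δ⌋).biUnion fun ij =>
      (Finset.Icc ⌊(base ij.1 ij.2 - η) / δ - 1⌋ ⌊(base ij.1 ij.2 + η) / δ⌋).image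
        fun l => ![ij.1, ij.2, l]
  have hsub : {k : Fin 3 → ℤ | (meshCube δ k ∩ graphOnRect a b c d F).Nonempty} ⊆ S := by
    rintro k ⟨-, hk, z, hz, rfl⟩
    have h0 : z.1 ∈ Icc ((k 0 : ℝ) * δ) ((k 0 + 1) * δ) := by simpa using hk 0
    have h1 : z.2 ∈ Icc ((k 1 : ℝ) * δ) ((k 1 + 1) * δ) := by simpa using hk 1
    have h2 : F z ∈ Icc ((k 2 : ℝ) * δ) ((k 2 + 1) * δ) := by simpa using hk 2
    have hcol : z ∈ col (k 0) (k 1) := ⟨hz, h0, h1⟩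
    have hne : (col (k 0) (k 1)).Nonempty := ⟨z, hcol⟩
    have hb : base (k 0) (k 1) = F hne.some := dif_pos hne
    obtain ⟨hw, hw0, hw1⟩ := hne.some_mem
    have hd : |F z - base (k 0) (k 1)| ≤ η := by
      rw [hb]
      refine hF z hz _ hw ?_ ?_
      · rw [abs_le]; constructor <;> linarith [h0.1, h0.2, hw0.1, hw0.2]
      · rw [abs_le]; constructor <;> linarith [h1.1, h1.2, hw1.1, hw1.2]
    rw [abs_le] at hd
    simp only [S, Finset.coe_biUnion, mem_iUnion, Finset.mem_coe, Finset.mem_image]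
    refine ⟨(k 0, k 1), Finset.mem_product.2 ⟨mem_Icc_floor_of_mem_cell hδ hz.1 h0,
      mem_Icc_floor_of_mem_cell hδ hz.2 h1⟩, k 2, mem_Icc_floor_of_mem_cell hδ
        (x := F z) ⟨by linarith, by linarith⟩ h2, ?_⟩
    ext i
    fin_cases i <;> rfl
  have hint {u v : ℝ} (huv : u ≤ v) :
      ((Finset.Icc ⌊u / δ - 1⌋ ⌊v / δ⌋).card : ℝ) ≤ (v - u) / δ + 3 := by
    have h : u / δ ≤ v / δ := by gcongr
    have := card_Icc_floor_le (u := u / δ - 1) (v := v / δ) (by linarith)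
    rw [sub_div]; linarith
  have hcard : (S.card : ℝ) ≤ ((b - a) / δ + 3) * ((d - c) / δ + 3) * (2 * η / δ + 3) := by
    calc (S.card : ℝ) ≤ ∑ ij ∈ Finset.Icc ⌊a / δ - 1⌋ ⌊b / δ⌋ ×ˢ
          Finset.Icc ⌊c / δ - 1⌋ ⌊d / δ⌋, (2 * η / δ + 3) := by
          refine (Nat.cast_le.2 Finset.card_biUnion_le).trans ?_
          rw [Nat.cast_sum]
          refine Finset.sum_le_sum fun ij _ => ?_
          refine (Nat.cast_le.2 Finset.card_image_le).trans ?_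
          refine (hint (by linarith)).trans (le_of_eq ?_)
          ring
      _ ≤ _ := by
          rw [Finset.sum_const, nsmul_eq_mul, Finset.card_product, Nat.cast_mul]
          have := sub_nonneg.2 hab
          gcongr
          · exact hint hab
          · exact hint hcd
  calc (meshCount δ (graphOnRect a b c d F) : ℝ≥0∞) ≤ ((S.card : ℕ∞) : ℝ≥0∞) := by
        have := Set.encard_le_encard hsub
        rw [Set.encard_coe_eq_coe_finsetCard] at this
        exact_mod_cast this
    _ = ENNReal.ofReal S.card := by simp
    _ ≤ _ := ENNReal.ofReal_le_ofReal hcard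

theorem upperBoxDim_le_of_meshCount_le {n : ℕ} {A : Set (EuclideanSpace ℝ (Fin n))} {C r : ℝ}
    (hC : 0 < C)
    (h : ∀ δ ∈ Ioo (0 : ℝ) 1, (meshCount δ A : ℝ≥0∞) ≤ ENNReal.ofReal (C * δ ^ (-r))) :
    upperBoxDim A ≤ r := by
  have hlim : Tendsto (fun δ : ℝ => ((Real.log C / (-Real.log δ) + r : ℝ) : EReal))
      (𝓝[>] 0) (𝓝 (r : EReal)) := by
    refine (continuous_coe_real_ereal.tendsto r).comp ?_
    have h1 : Tendsto (fun δ : ℝ => -Real.log δ) (𝓝[>] 0) atTop :=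
      tendsto_neg_atBot_atTop.comp Real.tendsto_log_nhdsGT_zero
    simpa using (h1.const_div_atTop (Real.log C)).add_const r
  rw [upperBoxDim, ← hlim.limsup_eq]
  refine limsup_le_limsup ?_
  filter_upwards [Ioo_mem_nhdsGT (zero_lt_one' ℝ)] with δ hδ
  have hl : 0 < -Real.log δ := neg_pos.2 (Real.log_neg hδ.1 hδ.2)
  have hp := Real.rpow_pos_of_pos hδ.1 (-r)
  rw [boxRatio, EReal.div_le_iff_le_mul (by exact_mod_cast hl) (by exact EReal.coe_ne_top _)]
  refine (ENNReal.log_monotone (h δ hδ)).trans ?_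
  rw [ENNReal.log_ofReal_of_pos (by positivity), Real.log_mul hC.ne' hp.ne', Real.log_rpow hδ.1,
    ← EReal.coe_mul]
  apply le_of_eq
  congr 1
  rw [mul_add, mul_div_cancel₀ _ hl.ne']
  ring

theorem upperBoxDim_graphOnRect_le {a b c d : ℝ} (hab : a ≤ b) (hcd : c ≤ d) {F : ℝ × ℝ → ℝ}
    {γ K : ℝ} (hγ : γ ≤ 1) (hK : 0 ≤ K)
    (hF : ∀ δ ∈ Ioo (0 : ℝ) 1, ∀ z ∈ Icc a b ×ˢ Icc c d, ∀ w ∈ Icc a b ×ˢ Icc c d,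
      |z.1 - w.1| ≤ δ → |z.2 - w.2| ≤ δ → |F z - F w| ≤ K * δ ^ γ) :
    upperBoxDim (graphOnRect a b c d F) ≤ ((3 - γ : ℝ) : EReal) := by
  have hab' := sub_nonneg.2 hab
  have hcd' := sub_nonneg.2 hcd
  refine upperBoxDim_le_of_meshCount_le
    (C := (b - a + 3) * (d - c + 3) * (2 * K + 3)) (by positivity) fun δ hδ => ?_
  have h0 := hδ.1
  refine (meshCount_graphOnRect_le hab hcd h0 (by positivity) (hF δ hδ)).trans
    (ENNReal.ofReal_le_ofReal ?_)
  -- For `δ < 1` and `γ ≤ 1` the additive 3's are absorbed by `1 / δ` and `δ ^ (γ - 1)`, both at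
  -- least 1.
  have e1 : 3 ≤ 3 / δ := by rw [le_div_iff₀ h0]; linarith [hδ.2]
  have e2 : δ ^ γ / δ = δ ^ (γ - 1) := by rw [Real.rpow_sub_one h0.ne']
  have e3 : 1 ≤ δ ^ (γ - 1) :=
    Real.one_le_rpow_of_pos_of_le_one_of_nonpos h0 hδ.2.le (by linarith)
  have e4 : δ ^ (-(3 - γ)) = 1 / δ * (1 / δ) * δ ^ (γ - 1) := by
    rw [show -(3 - γ) = (γ - 1) + (-1) + (-1) by ring, Real.rpow_add h0, Real.rpow_add h0,
      Real.rpow_neg_one]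
    ring
  calc _ ≤ ((b - a + 3) / δ) * ((d - c + 3) / δ) * ((2 * K + 3) * δ ^ (γ - 1)) := by
        have i1 : (b - a) / δ + 3 ≤ (b - a + 3) / δ := by rw [add_div]; linarith
        have i2 : (d - c) / δ + 3 ≤ (d - c + 3) / δ := by rw [add_div]; linarith
        have i3 : 2 * (K * δ ^ γ) / δ + 3 ≤ (2 * K + 3) * δ ^ (γ - 1) := by
          rw [← mul_assoc, mul_div_assoc, e2, add_mul]
          linarith
        gcongr
    _ = _ := by rw [e4]; ring

/-! ### The one-dimensional Katugampola integral -/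

open MeasureTheory intervalIntegral in
theorem abs_integral_mul_le {u v M : ℝ} (huv : u ≤ v) {φ g : ℝ → ℝ}
    (hφ : IntervalIntegrable φ volume u v) (h0 : ∀ s ∈ Ioo u v, 0 ≤ φ s)
    (hg : ∀ s ∈ Ioo u v, |g s| ≤ M) :
    |∫ s in u..v, φ s * g s| ≤ M * ∫ s in u..v, φ s := by
  rw [← intervalIntegral.integral_const_mul, ← Real.norm_eq_abs]
  refine norm_integral_le_of_norm_le huv ?_ (hφ.const_mul M)
  -- The right endpoint is discarded: for `α < 1` the kernel takes the default value `0 ^ (α - 1) =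
  -- 0` there, which would spoil the sign of kernel differences.
  filter_upwards [Measure.ae_ne volume v] with s hsv hs
  have hs' : s ∈ Ioo u v := ⟨hs.1, lt_of_le_of_ne hs.2 hsv⟩
  rw [Real.norm_eq_abs, abs_mul, abs_of_nonneg (h0 s hs'), mul_comm]
  exact mul_le_mul_of_nonneg_right (hg s hs') (h0 s hs')

theorem exists_lipschitz_rpow {u v r : ℝ} (h : 0 < u ∨ 1 ≤ r) :
    ∃ L, 0 ≤ L ∧ ∀ x ∈ Icc u v, ∀ y ∈ Icc u v, |x ^ r - y ^ r| ≤ L * |x - y| := by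
  have hc : ContinuousOn (fun x : ℝ => r * x ^ (r - 1)) (Icc u v) := by
    refine continuousOn_const.mul (continuousOn_id.rpow_const fun x hx => ?_)
    rcases h with h | h
    · exact Or.inl (h.trans_le hx.1).ne'
    · exact Or.inr (by linarith)
  obtain ⟨L, hL⟩ := isCompact_Icc.exists_bound_of_continuousOn hc
  refine ⟨max L 0, le_max_right _ _, fun x hx y hy => ?_⟩
  have := (convex_Icc u v).norm_image_sub_le_of_norm_hasDerivWithin_le
    (f := fun x : ℝ => x ^ r) (f' := fun x => r * x ^ (r - 1)) (C := max L 0)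
    (fun x hx => (Real.hasDerivAt_rpow_const
      (h.imp (fun h => (h.trans_le hx.1).ne') id)).hasDerivWithinAt)
    (fun x hx => (hL x hx).trans (le_max_left _ _)) hy hx
  simpa only [Real.norm_eq_abs] using this

/-- The kernel of the one-dimensional Katugampola integral, without its normalising constant. -/
noncomputable def katugampolaKernel (p α x s : ℝ) : ℝ := (x ^ (p + 1) - s ^ (p + 1)) ^ (α - 1) * s ^ p

section Kernel

variable {p α u v x : ℝ}

theorem katugampolaKernel_nonneg (hp : -1 < p) (hu : 0 ≤ u) (hux : u ≤ x) :
    0 ≤ katugampolaKernel p α x u := by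
  have : u ^ (p + 1) ≤ x ^ (p + 1) := Real.rpow_le_rpow hu hux (by linarith)
  exact mul_nonneg (Real.rpow_nonneg (by linarith) _) (Real.rpow_nonneg hu _)

/-- The primitive of the kernel. -/
noncomputable def kernelPrimitive (p α x s : ℝ) : ℝ :=
  -((x ^ (p + 1) - s ^ (p + 1)) ^ α / (α * (p + 1)))

theorem hasDerivAt_kernelPrimitive (hp : -1 < p) (hα : 0 < α) (hu : 0 < u) (hux : u < x) :
    HasDerivAt (kernelPrimitive p α x) (katugampolaKernel p α x u) u := by
  have hp' : p + 1 ≠ 0 := by linarith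
  have hlt : u ^ (p + 1) < x ^ (p + 1) := Real.rpow_lt_rpow hu.le hux (by linarith)
  have h1 := (Real.hasDerivAt_rpow_const (p := p + 1) (Or.inl hu.ne')).const_sub (x ^ (p + 1))
  have h2 := ((h1.rpow_const (p := α) (Or.inl (sub_pos.2 hlt).ne')).div_const
    (α * (p + 1))).neg
  refine h2.congr_deriv ?_
  rw [katugampolaKernel, add_sub_cancel_right]
  field_simp

theorem continuousOn_kernelPrimitive (hα : 0 < α) (hu : 0 < u) :
    ContinuousOn (kernelPrimitive p α x) (Icc u v) := by
  have h : ContinuousOn (fun s : ℝ => s ^ (p + 1)) (Icc u v) :=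
    continuousOn_id.rpow_const fun s hs => Or.inl (hu.trans_le hs.1).ne'
  exact (((continuousOn_const.sub h).rpow_const fun _ _ => Or.inr hα.le).div_const _).neg

-- For `α < 1` the kernel is singular at `s = x`; it is integrable as the nonnegative derivative of
-- a primitive continuous up to the endpoint.
open MeasureTheory in
theorem intervalIntegrable_katugampolaKernel (hp : -1 < p) (hα : 0 < α) (hu : 0 < u)
    (huv : u ≤ v) (hvx : v ≤ x) : IntervalIntegrable (katugampolaKernel p α x) volume u v := by
  rw [intervalIntegrable_iff_integrableOn_Ioc_of_le huv]
  exact intervalIntegral.integrableOn_deriv_of_nonneg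
    (continuousOn_kernelPrimitive (p := p) (x := x) hα hu)
    (fun s hs => hasDerivAt_kernelPrimitive hp hα (hu.trans hs.1) (hs.2.trans_le hvx))
    (fun s hs => katugampolaKernel_nonneg hp (hu.trans hs.1).le (hs.2.le.trans hvx))

theorem integral_katugampolaKernel (hp : -1 < p) (hα : 0 < α) (hu : 0 < u)
    (huv : u ≤ v) (hvx : v ≤ x) : ∫ s in u..v, katugampolaKernel p α x s =
      ((x ^ (p + 1) - u ^ (p + 1)) ^ α - (x ^ (p + 1) - v ^ (p + 1)) ^ α) / (α * (p + 1)) := by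
  rw [intervalIntegral.integral_eq_sub_of_hasDerivAt_of_le huv
    (continuousOn_kernelPrimitive (p := p) (x := x) hα hu)
    (fun s hs => hasDerivAt_kernelPrimitive hp hα (hu.trans hs.1) (hs.2.trans_le hvx))
    (intervalIntegrable_katugampolaKernel hp hα hu huv hvx)]
  simp only [kernelPrimitive]
  ring

open MeasureTheory in
theorem intervalIntegrable_katugampolaKernel_mul (hp : -1 < p) (hα : 0 < α) (hu : 0 < u)
    (huv : u ≤ v) (hvx : v ≤ x) {g : ℝ → ℝ} (hg : ContinuousOn g (Icc u v)) :
    IntervalIntegrable (fun s => katugampolaKernel p α x s * g s) volume u v :=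
  (intervalIntegrable_katugampolaKernel hp hα hu huv hvx).mul_continuousOn
    (by rwa [uIcc_of_le huv])

end Kernel

/-- The one-dimensional Katugampola integral, without its normalising constant. -/
noncomputable def katugampolaIntegral (a p α x : ℝ) (g : ℝ → ℝ) : ℝ :=
  ∫ s in a..x, katugampolaKernel p α x s * g s

-- The increment splits into the kernel difference on `[a, x]` and the new piece on `[x, x']`. Each
-- integrand has constant sign apart from `g`, so `M` factors out and the primitive evaluates the
-- rest.
open MeasureTheory in
theorem abs_katugampolaIntegral_sub_le {a p α x x' M : ℝ} (hp : -1 < p) (hα : 0 < α) (ha : 0 < a)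
    (hax : a ≤ x) (hxx' : x ≤ x') {g : ℝ → ℝ} (hg : ContinuousOn g (Icc a x'))
    (hM : ∀ s ∈ Icc a x', |g s| ≤ M) :
    |katugampolaIntegral a p α x' g - katugampolaIntegral a p α x g| ≤
      M * ((|(x' ^ (p + 1) - a ^ (p + 1)) ^ α - (x' ^ (p + 1) - x ^ (p + 1)) ^ α -
        (x ^ (p + 1) - a ^ (p + 1)) ^ α| + (x' ^ (p + 1) - x ^ (p + 1)) ^ α) /
          (α * (p + 1))) := by
  have hx0 : 0 < x := ha.trans_le hax
  have hp1 : 0 < p + 1 := by linarith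
  have hM0 : 0 ≤ M := (abs_nonneg _).trans (hM a ⟨le_rfl, hax.trans hxx'⟩)
  have hg1 : ContinuousOn g (Icc a x) := hg.mono (Icc_subset_Icc_right hxx')
  have hg2 : ContinuousOn g (Icc x x') := hg.mono (Icc_subset_Icc_left hax)
  have i1 := intervalIntegrable_katugampolaKernel_mul hp hα ha hax le_rfl hg1
  have i2 := intervalIntegrable_katugampolaKernel_mul hp hα ha hax hxx' hg1
  have i3 := intervalIntegrable_katugampolaKernel_mul hp hα hx0 hxx' le_rfl hg2
  have k1 := intervalIntegrable_katugampolaKernel hp hα ha hax le_rfl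
  have k2 := intervalIntegrable_katugampolaKernel hp hα ha hax hxx'
  have k3 := intervalIntegrable_katugampolaKernel hp hα hx0 hxx' le_rfl
  have hsplit : katugampolaIntegral a p α x' g - katugampolaIntegral a p α x g =
      (∫ s in a..x, (katugampolaKernel p α x' s - katugampolaKernel p α x s) * g s) +
        ∫ s in x..x', katugampolaKernel p α x' s * g s := by
    simp only [katugampolaIntegral, sub_mul]
    rw [intervalIntegral.integral_sub i2 i1,
      ← intervalIntegral.integral_add_adjacent_intervals i2 i3]
    ring
  have hval : ∫ s in a..x, (katugampolaKernel p α x' s - katugampolaKernel p α x s) =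
      ((x' ^ (p + 1) - a ^ (p + 1)) ^ α - (x' ^ (p + 1) - x ^ (p + 1)) ^ α -
        (x ^ (p + 1) - a ^ (p + 1)) ^ α) / (α * (p + 1)) := by
    rw [intervalIntegral.integral_sub k2 k1, integral_katugampolaKernel hp hα ha hax hxx',
      integral_katugampolaKernel hp hα ha hax le_rfl, sub_self, Real.zero_rpow hα.ne']
    ring
  have hgM : ∀ s ∈ Ioo a x, |g s| ≤ M := fun s hs => hM s ⟨hs.1.le, hs.2.le.trans hxx'⟩
  have first : |∫ s in a..x, (katugampolaKernel p α x' s - katugampolaKernel p α x s) * g s| ≤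
      M * |∫ s in a..x, (katugampolaKernel p α x' s - katugampolaKernel p α x s)| := by
    have hlt {s : ℝ} (hs : s ∈ Ioo a x) : 0 < x ^ (p + 1) - s ^ (p + 1) :=
      sub_pos.2 (Real.rpow_lt_rpow (ha.trans hs.1).le hs.2 hp1)
    have hle (s : ℝ) : x ^ (p + 1) - s ^ (p + 1) ≤ x' ^ (p + 1) - s ^ (p + 1) :=
      sub_le_sub_right (Real.rpow_le_rpow hx0.le hxx' hp1.le) _
    -- The kernel increases with `x` when `α ≥ 1` and decreases when `α ≤ 1`.
    rcases le_total 1 α with h1 | h1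
    · refine (abs_integral_mul_le hax (k2.sub k1) (fun s hs => ?_) hgM).trans
        (mul_le_mul_of_nonneg_left (le_abs_self _) hM0)
      refine sub_nonneg.2 (mul_le_mul_of_nonneg_right ?_ (Real.rpow_nonneg (ha.trans hs.1).le _))
      exact Real.rpow_le_rpow (hlt hs).le (hle s) (by linarith)
    · have := abs_integral_mul_le hax (k1.sub k2) (fun s hs => ?_) hgM
      · rw [← abs_neg, ← intervalIntegral.integral_neg,
          ← abs_neg (∫ s in a..x, (katugampolaKernel p α x' s - katugampolaKernel p α x s)),
          ← intervalIntegral.integral_neg]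
        simp only [← neg_mul, neg_sub]
        exact this.trans (mul_le_mul_of_nonneg_left (le_abs_self _) hM0)
      · refine sub_nonneg.2 (mul_le_mul_of_nonneg_right ?_ (Real.rpow_nonneg (ha.trans hs.1).le _))
        exact Real.rpow_le_rpow_of_nonpos (hlt hs) (hle s) (by linarith)
  have second := abs_integral_mul_le hxx' k3
    (fun s hs => katugampolaKernel_nonneg hp (hx0.trans hs.1).le hs.2.le)
    (fun s hs => hM s ⟨hax.trans hs.1.le, hs.2.le⟩)
  rw [integral_katugampolaKernel hp hα hx0 hxx' le_rfl, sub_self, Real.zero_rpow hα.ne',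
    sub_zero] at second
  rw [hval, abs_div, abs_of_pos (mul_pos hα hp1)] at first
  rw [hsplit, add_div, mul_add]
  exact (abs_add_le _ _).trans (add_le_add first second)

/-- The Katugampola integral of order `α` maps bounded functions to Hölder functions of exponent
`min α 1`. -/
theorem exists_holder_katugampolaIntegral {a b p α : ℝ} (hp : -1 < p) (hα : 0 < α) (ha : 0 < a) :
    ∃ K, 0 ≤ K ∧ ∀ x ∈ Icc a b, ∀ x' ∈ Icc a b, ∀ (g : ℝ → ℝ) (M : ℝ),
      ContinuousOn g (Icc a b) → (∀ s ∈ Icc a b, |g s| ≤ M) →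
      |katugampolaIntegral a p α x g - katugampolaIntegral a p α x' g| ≤
        M * (K * |x - x'| ^ min α 1) := by
  have hp1 : 0 < p + 1 := by linarith
  obtain ⟨L, hL0, hL⟩ := exists_lipschitz_rpow (u := a) (v := b) (r := p + 1) (Or.inl ha)
  suffices h : ∃ K, 0 ≤ K ∧ ∀ x ∈ Icc a b, ∀ x' ∈ Icc a b, x ≤ x' →
      |(x' ^ (p + 1) - a ^ (p + 1)) ^ α - (x' ^ (p + 1) - x ^ (p + 1)) ^ α -
        (x ^ (p + 1) - a ^ (p + 1)) ^ α| + (x' ^ (p + 1) - x ^ (p + 1)) ^ α ≤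
          K * |x - x'| ^ min α 1 by
    obtain ⟨K, hK0, hK⟩ := h
    have key : ∀ x ∈ Icc a b, ∀ x' ∈ Icc a b, x ≤ x' → ∀ (g : ℝ → ℝ) (M : ℝ),
        ContinuousOn g (Icc a b) → (∀ s ∈ Icc a b, |g s| ≤ M) →
        |katugampolaIntegral a p α x' g - katugampolaIntegral a p α x g| ≤
          M * (K / (α * (p + 1)) * |x - x'| ^ min α 1) := by
      intro x hx x' hx' hxx' g M hg hM
      have hsub : Icc a x' ⊆ Icc a b := Icc_subset_Icc_right hx'.2
      have hM0 : 0 ≤ M := (abs_nonneg _).trans (hM x hx)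
      refine (abs_katugampolaIntegral_sub_le hp hα ha hx.1 hxx' (hg.mono hsub)
        fun s hs => hM s (hsub hs)).trans (mul_le_mul_of_nonneg_left ?_ hM0)
      rw [div_mul_eq_mul_div]
      exact div_le_div_of_nonneg_right (hK x hx x' hx' hxx') (by positivity)
    refine ⟨K / (α * (p + 1)), by positivity, fun x hx x' hx' g M hg hM => ?_⟩
    rcases le_total x x' with h | h
    · rw [abs_sub_comm]
      exact key x hx x' hx' h g M hg hM
    · rw [abs_sub_comm x x']
      exact key x' hx' x hx h g M hg hM
  have hmono {x y : ℝ} (hx : x ∈ Icc a b) (hxy : x ≤ y) : x ^ (p + 1) ≤ y ^ (p + 1) :=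
    Real.rpow_le_rpow (ha.le.trans hx.1) hxy hp1.le
  have hdiff {x x' : ℝ} (hx : x ∈ Icc a b) (hx' : x' ∈ Icc a b) :
      x' ^ (p + 1) - x ^ (p + 1) ≤ L * |x - x'| := by
    rw [abs_sub_comm]
    exact (le_abs_self _).trans (hL x' hx' x hx)
  rcases le_total α 1 with h1 | h1
  -- Subadditivity and monotonicity of `t ^ α` bound the absolute value by `(x' ^ (p + 1) - x ^ (p +
  -- 1)) ^ α`; the second summand is another copy, hence the 2.
  · refine ⟨2 * L ^ α, by positivity, fun x hx x' hx' hxx' => ?_⟩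
    have hA : a ∈ Icc a b := ⟨le_rfl, hx.1.trans hx.2⟩
    have e1 := hmono hA hx.1
    have e2 := hmono hx hxx'
    have e3 : (x ^ (p + 1) - a ^ (p + 1)) ^ α ≤ (x' ^ (p + 1) - a ^ (p + 1)) ^ α :=
      Real.rpow_le_rpow (by linarith) (by linarith) hα.le
    have e4 : (x' ^ (p + 1) - a ^ (p + 1)) ^ α ≤
        (x' ^ (p + 1) - x ^ (p + 1)) ^ α + (x ^ (p + 1) - a ^ (p + 1)) ^ α := by
      have := Real.rpow_add_le_add_rpow (p := α) (sub_nonneg.2 e2) (sub_nonneg.2 e1) hα.le h1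
      rwa [sub_add_sub_cancel] at this
    have e5 : (x' ^ (p + 1) - x ^ (p + 1)) ^ α ≤ L ^ α * |x - x'| ^ α := by
      rw [← Real.mul_rpow hL0 (abs_nonneg _)]
      exact Real.rpow_le_rpow (by linarith) (hdiff hx hx') hα.le
    rw [min_eq_left h1, abs_of_nonpos (by linarith)]
    linarith
  · obtain ⟨N, hN0, hN⟩ := exists_lipschitz_rpow (u := 0) (v := b ^ (p + 1) - a ^ (p + 1))
      (r := α) (Or.inr h1)
    -- Here `t ^ α` is Lipschitz: two increments in the absolute value and one in the last summand
    -- give the 3.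
    refine ⟨3 * (N * L), by positivity, fun x hx x' hx' hxx' => ?_⟩
    have hA : a ∈ Icc a b := ⟨le_rfl, hx.1.trans hx.2⟩
    have e1 := hmono hA hx.1
    have e2 := hmono hx hxx'
    have e3 := hmono hx' hx'.2
    have e4 := hN (x' ^ (p + 1) - a ^ (p + 1)) ⟨by linarith, by linarith⟩
      (x ^ (p + 1) - a ^ (p + 1)) ⟨by linarith, by linarith⟩
    have e5 := hN (x' ^ (p + 1) - x ^ (p + 1)) ⟨by linarith, by linarith⟩
      0 ⟨le_rfl, by linarith⟩
    have e6 := mul_le_mul_of_nonneg_left (hdiff hx hx') hN0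
    rw [sub_sub_sub_cancel_right, abs_of_nonneg (sub_nonneg.2 e2)] at e4
    rw [Real.zero_rpow hα.ne', sub_zero, sub_zero, abs_of_nonneg (sub_nonneg.2 e2),
      abs_of_nonneg (Real.rpow_nonneg (sub_nonneg.2 e2) _)] at e5
    have e7 : 0 ≤ (x' ^ (p + 1) - x ^ (p + 1)) ^ α := Real.rpow_nonneg (sub_nonneg.2 e2) _
    have e8 : |(x' ^ (p + 1) - a ^ (p + 1)) ^ α - (x' ^ (p + 1) - x ^ (p + 1)) ^ α -
        (x ^ (p + 1) - a ^ (p + 1)) ^ α| ≤ 2 * (N * (x' ^ (p + 1) - x ^ (p + 1))) := by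
      rw [abs_le] at e4 ⊢
      constructor <;> linarith [e4.1, e4.2]
    rw [min_eq_right h1, Real.rpow_one]
    linarith

/-! ### The mixed integral as an iterated one-dimensional integral -/

theorem mixedKatugampola_eq (a c p q α β : ℝ) (f : ℝ × ℝ → ℝ) (z : ℝ × ℝ) :
    mixedKatugampola a c p q α β f z =
      (p + 1) ^ (1 - α) * (q + 1) ^ (1 - β) / (Real.Gamma α * Real.Gamma β) *
        katugampolaIntegral a p α z.1 fun s => katugampolaIntegral c q β z.2 fun t => f (s, t) := by
  simp only [mixedKatugampola, katugampolaIntegral, katugampolaKernel]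
  congr 1
  refine intervalIntegral.integral_congr fun s _ => ?_
  rw [← intervalIntegral.integral_const_mul]
  refine intervalIntegral.integral_congr fun t _ => ?_
  ring

theorem katugampolaIntegral_self (a p α : ℝ) (g : ℝ → ℝ) : katugampolaIntegral a p α a g = 0 :=
  intervalIntegral.integral_same

theorem katugampolaIntegral_sub {a p α x : ℝ} (hp : -1 < p) (hα : 0 < α) (ha : 0 < a)
    (hax : a ≤ x) {g h : ℝ → ℝ} (hg : ContinuousOn g (Icc a x)) (hh : ContinuousOn h (Icc a x)) :
    katugampolaIntegral a p α x (fun s => g s - h s) =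
      katugampolaIntegral a p α x g - katugampolaIntegral a p α x h := by
  simp only [katugampolaIntegral, mul_sub]
  exact intervalIntegral.integral_sub
    (intervalIntegrable_katugampolaKernel_mul hp hα ha hax le_rfl hg)
    (intervalIntegrable_katugampolaKernel_mul hp hα ha hax le_rfl hh)

-- Dominated convergence with majorant kernel times `M`. The outer integral can then be estimated,
-- since the one-dimensional bound asks for a continuous integrand.
open MeasureTheory in
theorem continuousOn_katugampolaIntegral_param {S : Set ℝ} {c d q β y M : ℝ} {f : ℝ × ℝ → ℝ}
    (hq : -1 < q) (hβ : 0 < β) (hc : 0 < c) (hy : y ∈ Icc c d)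
    (hf : ContinuousOn f (S ×ˢ Icc c d)) (hM : ∀ z ∈ S ×ˢ Icc c d, |f z| ≤ M) :
    ContinuousOn (fun s => katugampolaIntegral c q β y fun t => f (s, t)) S := by
  intro s₀ hs₀
  have hsub {t : ℝ} (ht : t ∈ uIoc c y) : t ∈ Icc c d ∧ t ≤ y := by
    rw [uIoc_of_le hy.1] at ht
    exact ⟨⟨ht.1.le, ht.2.trans hy.2⟩, ht.2⟩
  have hrow (s : ℝ) (hs : s ∈ S) : ContinuousOn (fun t => f (s, t)) (Icc c y) :=
    hf.comp (by fun_prop) fun t ht => ⟨hs, ht.1, ht.2.trans hy.2⟩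
  refine intervalIntegral.continuousWithinAt_of_dominated_interval
    (bound := fun t => katugampolaKernel q β y t * M) ?_ ?_
    ((intervalIntegrable_katugampolaKernel hq hβ hc hy.1 le_rfl).mul_const M) ?_
  · filter_upwards [self_mem_nhdsWithin] with s hs
    exact (intervalIntegrable_katugampolaKernel_mul hq hβ hc hy.1 le_rfl
      (hrow s hs)).def'.aestronglyMeasurable
  · filter_upwards [self_mem_nhdsWithin] with s hs
    refine Eventually.of_forall fun t ht => ?_
    have hk : 0 ≤ katugampolaKernel q β y t :=
      katugampolaKernel_nonneg hq (hc.le.trans (hsub ht).1.1) (hsub ht).2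
    rw [Real.norm_eq_abs, abs_mul, abs_of_nonneg hk]
    exact mul_le_mul_of_nonneg_left (hM _ ⟨hs, (hsub ht).1⟩) hk
  · refine Eventually.of_forall fun t ht => ?_
    have : ContinuousOn (fun s => f (s, t)) S :=
      hf.comp (by fun_prop) fun s hs => ⟨hs, (hsub ht).1⟩
    exact continuousWithinAt_const.mul (this s₀ hs₀)

theorem exists_holder_mixedKatugampola {a b c d p q α β : ℝ} {f : ℝ × ℝ → ℝ}
    (ha : 0 < a) (hc : 0 < c) (hp : -1 < p) (hq : -1 < q) (hα : 0 < α) (hβ : 0 < β)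
    (hf : ContinuousOn f (Icc a b ×ˢ Icc c d)) :
    ∃ K, 0 ≤ K ∧ ∀ z ∈ Icc a b ×ˢ Icc c d, ∀ w ∈ Icc a b ×ˢ Icc c d,
      |mixedKatugampola a c p q α β f z - mixedKatugampola a c p q α β f w| ≤
        K * (|z.1 - w.1| ^ min α 1 + |z.2 - w.2| ^ min β 1) := by
  obtain ⟨M, hM⟩ := (isCompact_Icc.prod isCompact_Icc).exists_bound_of_continuousOn hf
  simp only [Real.norm_eq_abs] at hM
  obtain ⟨K, hK0, hK⟩ := exists_holder_katugampolaIntegral (b := b) hp hα ha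
  obtain ⟨N, hN0, hN⟩ := exists_holder_katugampolaIntegral (b := d) hq hβ hc
  set C := (p + 1) ^ (1 - α) * (q + 1) ^ (1 - β) / (Real.Gamma α * Real.Gamma β) with hC
  set R := |b - a| ^ min α 1
  set Q := |d - c| ^ min β 1
  have hR : 0 ≤ R := by positivity
  have hQ : 0 ≤ Q := by positivity
  have hmα : 0 ≤ min α 1 := le_min hα.le zero_le_one
  have hmβ : 0 ≤ min β 1 := le_min hβ.le zero_le_one
  refine ⟨|C| * (|M| * (N * K * (Q + R))), by positivity, fun z hz w hw => ?_⟩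
  have hrow {s : ℝ} (hs : s ∈ Icc a b) : ContinuousOn (fun t => f (s, t)) (Icc c d) :=
    hf.comp (by fun_prop) fun t ht => ⟨hs, ht⟩
  set I : ℝ → ℝ → ℝ := fun y s => katugampolaIntegral c q β y fun t => f (s, t) with hI
  have hIc {y : ℝ} (hy : y ∈ Icc c d) : ContinuousOn (I y) (Icc a b) :=
    continuousOn_katugampolaIntegral_param hq hβ hc hy hf hM
  have hId {y y' : ℝ} (hy : y ∈ Icc c d) (hy' : y' ∈ Icc c d) :
      ∀ s ∈ Icc a b, |I y s - I y' s| ≤ |M| * (N * |y - y'| ^ min β 1) := fun s hs =>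
    hN y hy y' hy' _ _ (hrow hs) fun t ht => (hM _ ⟨hs, ht⟩).trans (le_abs_self M)
  have hcc : c ∈ Icc c d := ⟨le_rfl, hz.2.1.trans hz.2.2⟩
  have haa : a ∈ Icc a b := ⟨le_rfl, hz.1.1.trans hz.1.2⟩
  have hIb {y : ℝ} (hy : y ∈ Icc c d) : ∀ s ∈ Icc a b, |I y s| ≤ |M| * (N * Q) := by
    intro s hs
    -- The inner integral vanishes at `y = c`, so its Hölder bound against that point is a sup
    -- bound.
    have h := hId hy hcc s hs
    simp only [hI, katugampolaIntegral_self, sub_zero] at h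
    refine h.trans ?_
    gcongr
    have h1 := hy.1
    exact Real.rpow_le_rpow (abs_nonneg _) (abs_le_abs_of_nonneg (sub_nonneg.2 h1)
      (sub_le_sub_right hy.2 c)) hmβ
  have h1 := hK z.1 hz.1 w.1 hw.1 (I z.2) _ (hIc hz.2) (hIb hz.2)
  have h2 : |katugampolaIntegral a p α w.1 (I z.2) - katugampolaIntegral a p α w.1 (I w.2)| ≤
      |M| * (N * |z.2 - w.2| ^ min β 1) * (K * R) := by
    have hw1 : Icc a w.1 ⊆ Icc a b := Icc_subset_Icc_right hw.1.2
    rw [← katugampolaIntegral_sub hp hα ha hw.1.1 ((hIc hz.2).mono hw1) ((hIc hw.2).mono hw1)]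
    -- By linearity the increment in `y` passes inside; comparison with `x = a`, where the outer
    -- integral vanishes, bounds it.
    have h := hK w.1 hw.1 a haa (fun s => I z.2 s - I w.2 s) _ ((hIc hz.2).sub (hIc hw.2))
      (hId hz.2 hw.2)
    rw [katugampolaIntegral_self, sub_zero] at h
    refine h.trans ?_
    gcongr
    exact Real.rpow_le_rpow (abs_nonneg _) (abs_le_abs_of_nonneg (sub_nonneg.2 hw.1.1)
      (sub_le_sub_right hw.1.2 a)) hmα
  rw [mixedKatugampola_eq, mixedKatugampola_eq, ← hC, ← mul_sub, abs_mul, mul_assoc |C|]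
  refine mul_le_mul_of_nonneg_left ?_ (abs_nonneg C)
  refine (abs_sub_le _ (katugampolaIntegral a p α w.1 (I z.2)) _).trans
    ((add_le_add h1 h2).trans ?_)
  have e1 : 0 ≤ |M| * N * K * R * |z.1 - w.1| ^ min α 1 := by positivity
  have e2 : 0 ≤ |M| * N * K * Q * |z.2 - w.2| ^ min β 1 := by positivity
  linarith

/-! ### Dimensions of the graph -/

theorem upperBoxDim_graph_mixedKatugampola_le {a b c d p q α β : ℝ} {f : ℝ × ℝ → ℝ}
    (ha : 0 < a) (hab : a ≤ b) (hc : 0 < c) (hcd : c ≤ d) (hp : -1 < p) (hq : -1 < q)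
    (hα : 0 < α) (hβ : 0 < β) (hf : ContinuousOn f (Icc a b ×ˢ Icc c d)) :
    upperBoxDim (graphOnRect a b c d (mixedKatugampola a c p q α β f)) ≤
      ((3 - min (min α 1) (min β 1) : ℝ) : EReal) := by
  obtain ⟨K, hK0, hK⟩ := exists_holder_mixedKatugampola ha hc hp hq hα hβ hf
  refine upperBoxDim_graphOnRect_le hab hcd (K := K * 2) ((min_le_left _ _).trans (min_le_right _ _))
    (by positivity) fun δ hδ z hz w hw h1 h2 => (hK z hz w hw).trans ?_
  have hpow {r u : ℝ} (hu : 0 ≤ u) (huδ : u ≤ δ) (hr : 0 ≤ r)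
      (hr' : min (min α 1) (min β 1) ≤ r) : u ^ r ≤ δ ^ min (min α 1) (min β 1) :=
    (Real.rpow_le_rpow hu huδ hr).trans (Real.rpow_le_rpow_of_exponent_ge hδ.1 hδ.2.le hr')
  rw [mul_assoc, two_mul]
  gcongr
  · exact hpow (abs_nonneg _) h1 (le_min hα.le zero_le_one) (min_le_left _ _)
  · exact hpow (abs_nonneg _) h2 (le_min hβ.le zero_le_one) (min_le_right _ _)

theorem graphOnRect_nonempty {a b c d : ℝ} (hab : a ≤ b) (hcd : c ≤ d) (F : ℝ × ℝ → ℝ) :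
    (graphOnRect a b c d F).Nonempty :=
  ((nonempty_Icc.2 hab).prod (nonempty_Icc.2 hcd)).image _

theorem mainTheorem3 (a b c d p q : ℝ) (f : ℝ × ℝ → ℝ)
    (ha : 0 < a) (hab : a < b) (hc : 0 < c) (hcd : c < d)
    (hp : -1 < p) (hp0 : p ≤ 0) (hq : -1 < q) (hq0 : q ≤ 0)
    (hf : ContinuousOn f (Icc a b ×ˢ Icc c d)) :
    (∀ α β : ℝ, 0 < α → α < 1 → 0 < β → β < 1 →
      (2 : EReal) ≤ (dimH (graphOnRect a b c d (mixedKatugampola a c p q α β f)) : EReal) ∧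
      (dimH (graphOnRect a b c d (mixedKatugampola a c p q α β f)) : EReal) ≤
        lowerBoxDim (graphOnRect a b c d (mixedKatugampola a c p q α β f)) ∧
      lowerBoxDim (graphOnRect a b c d (mixedKatugampola a c p q α β f)) ≤
        upperBoxDim (graphOnRect a b c d (mixedKatugampola a c p q α β f)) ∧
      upperBoxDim (graphOnRect a b c d (mixedKatugampola a c p q α β f)) ≤
        ((3 - min α β : ℝ) : EReal)) ∧
    (∀ α β : ℝ, 1 ≤ α → 1 ≤ β →
      dimH (graphOnRect a b c d (mixedKatugampola a c p q α β f)) = 2 ∧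
      lowerBoxDim (graphOnRect a b c d (mixedKatugampola a c p q α β f)) = 2 ∧
      upperBoxDim (graphOnRect a b c d (mixedKatugampola a c p q α β f)) = 2) := by
  have htwo : ((2 : ℝ≥0∞) : EReal) = 2 := rfl
  have hdim (F : ℝ × ℝ → ℝ) : (2 : EReal) ≤ (dimH (graphOnRect a b c d F) : EReal) := by
    rw [← htwo]
    exact EReal.coe_ennreal_le_coe_ennreal_iff.2 (two_le_dimH_graphOnRect hab hcd F)
  have hlow (F : ℝ × ℝ → ℝ) := dimH_le_lowerBoxDim (graphOnRect_nonempty hab.le hcd.le F)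
  have hlu (F : ℝ × ℝ → ℝ) := lowerBoxDim_le_upperBoxDim (graphOnRect a b c d F)
  refine ⟨fun α β hα hα1 hβ hβ1 => ⟨hdim _, hlow _, hlu _, ?_⟩, fun α β hα hβ => ?_⟩
  · have h := upperBoxDim_graph_mixedKatugampola_le ha hab.le hc hcd.le hp hq hα hβ hf
    rwa [min_eq_left hα1.le, min_eq_left hβ1.le] at h
  · have h := upperBoxDim_graph_mixedKatugampola_le ha hab.le hc hcd.le hp hq
      (zero_lt_one.trans_le hα) (zero_lt_one.trans_le hβ) hf
    rw [min_eq_right hα, min_eq_right hβ, min_self, show (3 - 1 : ℝ) = 2 by norm_num] at h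
    set F := mixedKatugampola a c p q α β f
    have hl := (hlu F).trans h
    have hd := (hlow F).trans hl
    refine ⟨le_antisymm ?_ (two_le_dimH_graphOnRect hab hcd F),
      le_antisymm hl ((hdim F).trans (hlow F)),
      le_antisymm h (((hdim F).trans (hlow F)).trans (hlu F))⟩
    exact EReal.coe_ennreal_le_coe_ennreal_iff.1 (htwo ▸ hd)
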